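/- Let $\Sigma=\{a_1,\dots,a_k\}$ be a finite alphabet. For words $\boldsymbol w\in\Sigma^n$ and $\boldsymbol u\in\Sigma^\ell$ let $\binom{\boldsymbol w}{\boldsymbol u}$ be the number of sets of $\ell$ positions in $\boldsymbol w$ along which $\boldsymbol w$ spells $\boldsymbol u$, and let $t(\boldsymbol u,\boldsymbol w)=\binom{\boldsymbol w}{\boldsymbol u}\big/\binom n\ell$. A sequence $(\boldsymbol w_n)_{n}$ of words over $\Sigma$ whose lengths tend to infinity (for example $\boldsymbol w_n\in\Sigma^n$) is called convergent if $(t(\boldsymbol u,\boldsymbol w_n))_n$ converges for every finite word $\boldsymbol u$. Let $\mathcal T$ be the set of tuples $\boldsymbol f=(f^{a_1},\dots,f^{a_k})$ of Lebesgue measurable functions $f^{a_i}:[0,1]\to[0,1]$ with $f^{a_1}(x)+\dots+f^{a_k}(x)=1$ for almost every $x\in[0,1]$. For $\boldsymbol f\in\mathcal T$ and $\boldsymbol u=u_1\dots u_\ell\in\Sigma^\ell$ put $$t(\boldsymbol u,\boldsymbol f)=\ell!\int_{0\le x_1<\dots<x_\ell\le 1}\ \prod_{i=1}^{\ell}f^{u_i}(x_i)\,dx_1\cdots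 dx_\ell ,$$ and say that $(\boldsymbol w_n)_n$ converges to $\boldsymbol f$ if $t(\boldsymbol u,\boldsymbol w_n)\to t(\boldsymbol u,\boldsymbol f)$ for every finite word $\boldsymbol u$. An $\boldsymbol f$-random letter is a pair $(X,Y)$ of random variables such that $X$ is uniform on $[0,1]$ and, conditionally on $X=x$, $Y=a_i$ with probability $f^{a_i}(x)$ for each $i$. An $\boldsymbol f$-random word of length $n$ is $Y_{\sigma(1)}\dots Y_{\sigma(n)}$, where $(X_1,Y_1),\dots,(X_n,Y_n)$ are independent $\boldsymbol f$-random letters and $\sigma$ is a permutation with $X_{\sigma(1)}\le\dots\le X_{\sigma(n)}$. Theorem (Limits of convergent $k$-letter word sequences). 1. Every convergent sequence $(\boldsymbol w_n)_n$ of words over $\Sigma$ whose lengths tend to infinity converges to some $\boldsymbol f\in\mathcal T$. Moreover, if $(\boldsymbol w_n)_n$ also converges to $\boldsymbol g\in\mathcal T$, then $f^{a_i}=g^{a_i}$ almost everywhere for every $i$. 2. Conversely, for every $\boldsymbol f\in\mathcal T$ there is a sequence of words $\boldsymbol w_n\in\Sigma^n$ which converges to $\boldsymbol f$. In fact, if for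 each $n$ the random word $\boldsymbol W_n$ is an $\boldsymbol f$-random word of length $n$, all defined on one probability space (with any dependence between different $n$), then $(\boldsymbol W_n)_n$ converges to $\boldsymbol f$ almost surely. -/

import Mathlib

open MeasureTheory ProbabilityTheory Filter Topology unitInterval

noncomputable section

namespace WordLimits

/-- Words of length `n` over the alphabet `A`. -/
abbrev Word (A : Type*) (n : ℕ) : Type _ := Fin n → A

/-- The number of occurrences of `u` as a subsequence of `w`, that is, the number of increasing
choices of positions `e 0 < e 1 < ⋯` (equivalently, of `l`-element sets of positions) along which
`w` spells `u`. -/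
def occurrences {A : Type*} {l n : ℕ} (u : Word A l) (w : Word A n) : ℕ :=
  Nat.card {e : Fin l ↪o Fin n // ∀ j, w (e j) = u j}

/-- The subsequence density `t(u, w)`. -/
def density {A : Type*} {l n : ℕ} (u : Word A l) (w : Word A n) : ℝ :=
  (occurrences u w : ℝ) / (n.choose l : ℝ)

/-- A sequence of words is convergent if all its subsequence densities converge. -/
def Convergent {A : Type*} {len : ℕ → ℕ} (w : ∀ n, Word A (len n)) : Prop :=
  ∀ (l : ℕ) (u : Word A l), ∃ c : ℝ, Tendsto (fun n => density u (w n)) atTop (𝓝 c)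

/-- A tuple `(f a)`, indexed by the letters, of Lebesgue measurable functions `[0,1] → [0,1]`
whose sum is `1` almost everywhere. (A function is Lebesgue measurable iff it is almost everywhere
measurable with respect to the Lebesgue measure in the sense of `AEMeasurable`.) -/
structure IsLimitTuple {A : Type*} [Fintype A] (f : A → I → I) : Prop where
  aemeasurable : ∀ a, AEMeasurable (f a) (volume : Measure I)
  sum_eq_one : ∀ᵐ x ∂(volume : Measure I), ∑ a, (f a x : ℝ) = 1

/-- The density `t(u, f) = l! ∫_{x₁ < ⋯ < x_l} ∏ i, f^{u_i}(x_i)` of `u` in the tuple `f`. -/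
def limitDensity {A : Type*} {l : ℕ} (u : Word A l) (f : A → I → I) : ℝ :=
  (l.factorial : ℝ) * ∫ x in {x : Fin l → I | StrictMono x}, ∏ i, (f (u i) (x i) : ℝ)

/-- The sequence of words `w` converges to the tuple `f`. -/
def ConvergesTo {A : Type*} {len : ℕ → ℕ} (w : ∀ n, Word A (len n)) (f : A → I → I) : Prop :=
  ∀ (l : ℕ) (u : Word A l), Tendsto (fun n => density u (w n)) atTop (𝓝 (limitDensity u f))

/-- `(X, Y)` is an `f`-random letter: `X` is uniform on `[0,1]` and, conditionally on `X = x`,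
`Y` equals `a` with probability `f a x`. -/
structure IsRandomLetter {A Ω : Type*} [MeasurableSpace A] [MeasurableSpace Ω] (P : Measure Ω)
    (f : A → I → I) (X : Ω → I) (Y : Ω → A) : Prop where
  measurable_fst : Measurable X
  measurable_snd : Measurable Y
  uniform : P.map X = volume
  conditional : ∀ (a : A) (B : Set I), MeasurableSet B →
    P (X ⁻¹' B ∩ Y ⁻¹' {a}) = ∫⁻ x in B, ENNReal.ofReal (f a x : ℝ)

/-- `W` is the random word of length `n` obtained from `n` independent `f`-random letters
`(X j, Y j)` by listing the letters `Y j` in increasing order of the positions `X j`. -/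
def IsRandomWord {A Ω : Type*} [MeasurableSpace A] [MeasurableSpace Ω] (P : Measure Ω)
    (f : A → I → I) (n : ℕ) (W : Ω → Word A n) : Prop :=
  ∃ (X : Fin n → Ω → I) (Y : Fin n → Ω → A) (perm : Ω → Equiv.Perm (Fin n)),
    (∀ j, IsRandomLetter P f (X j) (Y j)) ∧
    iIndepFun (fun j ω => (X j ω, Y j ω)) P ∧
    (∀ ω, Monotone (fun j => X (perm ω j) ω)) ∧
    ∀ ω j, W ω j = Y (perm ω j) ω

end WordLimits

end

/-! A limit tuple `f` is the same thing, up to null sets, as a probability measure on `I × A` with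
uniform first marginal: `letterMeasure` gives one direction, Radon-Nikodym densities
(`exists_isLimitTuple_letterMeasure_eq`) the other. A word whose letters sit at distinct, increasing
positions in `I` has an empirical measure on `I × A`, and up to the factor `n ^ l / n.choose l → l!`
the density of `u` is the `l`-fold product of that measure evaluated at `spellingSet u`. The
frontier of this set lies in the diagonals, which are null for the limit, so weak convergence of
empirical measures gives convergence of all densities (`tendsto_density_of_tendsto_empirical`).

Existence: put the letters at grid points. Probability measures on the compact space `I × A` form a
compact space, and a limit along an ultrafilter has uniform marginal, hence comes from a tuple. The
densities converge by assumption, so their limits are those of the tuple.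

Random words: the empirical measures converge almost surely, by Hoeffding and Borel-Cantelli applied
to a countable dense set of test functions. No relation between different lengths is needed.

Uniqueness: summing the densities over all words of length `k + 1` ending in `a` yields the `k`-th
moment of `f a`, and moments determine a finite measure on `I`. -/

namespace WordLimits

open Set
open scoped ENNReal NNReal

/-! ### The law of a random letter. -/

section LetterMeasure

variable {A : Type*} [Fintype A]

/-- The law on `[0,1] × A` of an `f`-random letter. -/
noncomputable def letterMeasure [MeasurableSpace A] (f : A → I → I) : Measure (I × A) :=
  ∑ a, (volume.withDensity fun x => ENNReal.ofReal (f a x : ℝ)).map fun x => (x, a)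

lemma IsLimitTuple.aemeasurable_ofReal {f : A → I → I} (hf : IsLimitTuple f) (a : A) :
    AEMeasurable (fun x => ENNReal.ofReal (f a x : ℝ)) (volume : Measure I) :=
  (measurable_subtype_coe.comp_aemeasurable (hf.aemeasurable a)).ennreal_ofReal

lemma IsLimitTuple.sum_ofReal {f : A → I → I} (hf : IsLimitTuple f) :
    ∀ᵐ x ∂(volume : Measure I), ∑ a, ENNReal.ofReal (f a x : ℝ) = 1 := by
  filter_upwards [hf.sum_eq_one] with x hx
  rw [← ENNReal.ofReal_sum_of_nonneg fun a _ => (f a x).2.1, hx, ENNReal.ofReal_one]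

variable [MeasurableSpace A] [DiscreteMeasurableSpace A]

/-- Since `A` is finite, every measurable set is a finite disjoint union of its slices `B ×ˢ {a}`.
-/
lemma measure_ext_singleton {μ ν : Measure (I × A)} [IsFiniteMeasure μ]
    (h : ∀ (B : Set I) (a : A), MeasurableSet B → μ (B ×ˢ {a}) = ν (B ×ˢ {a})) : μ = ν := by
  classical
  ext S hS
  have hS' : S = ⋃ a, ((fun x => (x, a)) ⁻¹' S) ×ˢ {a} := by
    ext ⟨x, a⟩; simp
  have hm : ∀ a : A, MeasurableSet ((fun x : I => (x, a)) ⁻¹' S) := fun a =>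
    (measurable_id.prodMk measurable_const) hS
  have hd : Pairwise (Function.onFun Disjoint fun a : A =>
      ((fun x : I => (x, a)) ⁻¹' S) ×ˢ ({a} : Set A)) := by
    intro a b hab
    exact Set.disjoint_prod.2 (Or.inr (by simpa using hab))
  have hmm : ∀ a : A, MeasurableSet (((fun x : I => (x, a)) ⁻¹' S) ×ˢ ({a} : Set A)) := fun a =>
    (hm a).prod (measurableSet_singleton a)
  rw [hS', measure_iUnion hd hmm, measure_iUnion hd hmm]
  exact tsum_congr fun a => h _ a (hm a)

lemma letterMeasure_prod_singleton (f : A → I → I) {B : Set I} (hB : MeasurableSet B) (a : A) :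
    letterMeasure f (B ×ˢ {a}) = ∫⁻ x in B, ENNReal.ofReal (f a x : ℝ) := by
  classical
  have hmeas : ∀ b : A, Measurable fun x : I => (x, b) := fun b => measurable_id.prodMk measurable_const
  rw [letterMeasure, Measure.finsetSum_apply, Finset.sum_eq_single a]
  · rw [Measure.map_apply (hmeas a) (hB.prod (measurableSet_singleton a))]
    have : (fun x : I => (x, a)) ⁻¹' (B ×ˢ {a}) = B := by ext; simp
    rw [this, withDensity_apply _ hB]
  · intro b _ hb
    rw [Measure.map_apply (hmeas b) (hB.prod (measurableSet_singleton a))]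
    have : (fun x : I => (x, b)) ⁻¹' (B ×ˢ {a}) = ∅ := by ext; simp [hb]
    rw [this, measure_empty]
  · simp

lemma letterMeasure_map_fst {f : A → I → I} (hf : IsLimitTuple f) :
    (letterMeasure f).map Prod.fst = volume := by
  ext B hB
  rw [Measure.map_apply measurable_fst hB]
  have h1 : Prod.fst ⁻¹' B = ⋃ a : A, B ×ˢ ({a} : Set A) := by ext ⟨x, a⟩; simp
  have hd : Pairwise (Function.onFun Disjoint fun a : A => B ×ˢ ({a} : Set A)) := by
    intro a b hab
    exact Set.disjoint_prod.2 (Or.inr (by simpa using hab))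
  rw [h1, measure_iUnion hd fun a => hB.prod (measurableSet_singleton a), tsum_fintype]
  simp_rw [letterMeasure_prod_singleton f hB]
  rw [← lintegral_finsetSum' _ fun a _ => (hf.aemeasurable_ofReal a).restrict,
    lintegral_congr_ae (ae_restrict_of_ae hf.sum_ofReal)]
  simp

lemma isProbabilityMeasure_letterMeasure {f : A → I → I} (hf : IsLimitTuple f) :
    IsProbabilityMeasure (letterMeasure f) := by
  constructor
  rw [← preimage_univ (f := Prod.fst), ← Measure.map_apply measurable_fst MeasurableSet.univ,
    letterMeasure_map_fst hf, measure_univ]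

variable {Ω : Type*} [MeasurableSpace Ω] {P : Measure Ω} {f : A → I → I}

lemma IsRandomLetter.map_eq [IsProbabilityMeasure P] {X : Ω → I} {Y : Ω → A}
    (h : IsRandomLetter P f X Y) :
    P.map (fun ω => (X ω, Y ω)) = letterMeasure f := by
  have hXY : Measurable fun ω => (X ω, Y ω) := h.measurable_fst.prodMk h.measurable_snd
  have := Measure.isProbabilityMeasure_map (μ := P) hXY.aemeasurable
  refine measure_ext_singleton fun B a hB => ?_
  rw [Measure.map_apply hXY (hB.prod (measurableSet_singleton a)),
    letterMeasure_prod_singleton f hB, ← h.conditional a B hB]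
  rfl

lemma isRandomLetter_of_map_eq (hf : IsLimitTuple f) {Z : Ω → I × A} (hZ : Measurable Z)
    (h : P.map Z = letterMeasure f) :
    IsRandomLetter P f (fun ω => (Z ω).1) (fun ω => (Z ω).2) where
  measurable_fst := hZ.fst
  measurable_snd := hZ.snd
  uniform := by
    rw [← letterMeasure_map_fst hf, ← h, Measure.map_map measurable_fst hZ]
    rfl
  conditional a B hB := by
    rw [← letterMeasure_prod_singleton f hB, ← h,
      Measure.map_apply hZ (hB.prod (measurableSet_singleton a))]
    rfl

end LetterMeasure

/-! ### Products of measures with densities. -/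

section PiWithDensity

/-- It suffices to compare on boxes; there the integrand is a product of functions of single
coordinates, and coordinates are independent under `Measure.pi μ`. -/
lemma pi_withDensity {ι : Type*} [Fintype ι] {α : ι → Type*} [∀ i, MeasurableSpace (α i)]
    (μ : ∀ i, Measure (α i)) [∀ i, IsProbabilityMeasure (μ i)] (g : ∀ i, α i → ℝ≥0∞)
    (hg : ∀ i, AEMeasurable (g i) (μ i)) [∀ i, SigmaFinite ((μ i).withDensity (g i))] :
    Measure.pi (fun i => (μ i).withDensity (g i)) =
      (Measure.pi μ).withDensity fun x => ∏ i, g i (x i) := by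
  refine Measure.pi_eq (μ := fun i => (μ i).withDensity (g i)) fun s hs => ?_
  have hind : ∀ i, AEMeasurable ((s i).indicator (g i)) (μ i) := fun i => (hg i).indicator (hs i)
  rw [withDensity_apply _ (MeasurableSet.univ_pi hs),
    ← lintegral_indicator (MeasurableSet.univ_pi hs)]
  have h1 : (univ.pi s).indicator (fun x => ∏ i, g i (x i)) =
      fun x => ∏ i, (s i).indicator (g i) (x i) := by
    ext x
    by_cases hx : x ∈ univ.pi s
    · rw [indicator_of_mem hx]
      exact Finset.prod_congr rfl fun i _ => (indicator_of_mem (hx i (mem_univ i)) _).symm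
    · rw [indicator_of_notMem hx]
      simp only [Set.mem_pi, mem_univ, true_implies, not_forall] at hx
      obtain ⟨i, hi⟩ := hx
      exact (Finset.prod_eq_zero (Finset.mem_univ i) (indicator_of_notMem hi _)).symm
  -- The factorization of the integral needs measurable factors, so each is replaced by its
  -- measurable version.
  have h2 : (fun x => ∏ i, (s i).indicator (g i) (x i)) =ᵐ[Measure.pi μ]
      fun x => ∏ i, (hind i).mk _ (x i) := by
    have : ∀ i, ∀ᵐ x ∂Measure.pi μ, (s i).indicator (g i) (x i) = (hind i).mk _ (x i) := fun i =>
      (Measure.quasiMeasurePreserving_eval (μ := μ) i).ae (hind i).ae_eq_mk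
    filter_upwards [ae_all_iff.2 this] with x hx
    exact Finset.prod_congr rfl fun i _ => hx i
  rw [h1, lintegral_congr_ae h2,
    lintegral_prod_eq_prod_lintegral_of_indepFun Finset.univ (fun i (x : ∀ i, α i) => (hind i).mk _ (x i))
      (iIndepFun_pi fun i => (hind i).measurable_mk.aemeasurable)
      (fun i => (hind i).measurable_mk.comp (measurable_pi_apply i))]
  refine Finset.prod_congr rfl fun i _ => ?_
  rw [(measurePreserving_eval μ i).lintegral_comp (hind i).measurable_mk,
    ← lintegral_congr_ae (hind i).ae_eq_mk, lintegral_indicator (hs i), withDensity_apply _ (hs i)]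

end PiWithDensity

/-! ### The spelling set and its boundary. -/

section SpellingSet

variable {A : Type*}

/-- The set of tuples of letters with positions which are listed in increasing order of the
positions and spell `u`. -/
def spellingSet {l : ℕ} (u : Word A l) : Set (Fin l → I × A) :=
  {z | StrictMono (fun i => (z i).1) ∧ ∀ i, (z i).2 = u i}

lemma isOpen_setOf_strictMono (l : ℕ) : IsOpen {x : Fin l → I | StrictMono x} := by
  have : {x : Fin l → I | StrictMono x} = ⋂ (i) (j) (_ : i < j), {x | x i < x j} := by
    ext x; simp [StrictMono]
  rw [this]
  exact isOpen_iInter_of_finite fun i => isOpen_iInter_of_finite fun j =>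
    isOpen_iInter_of_finite fun _ => isOpen_lt (continuous_apply i) (continuous_apply j)

lemma measurableSet_setOf_strictMono (l : ℕ) : MeasurableSet {x : Fin l → I | StrictMono x} :=
  (isOpen_setOf_strictMono l).measurableSet

lemma volume_setOf_apply_eq {l : ℕ} {i j : Fin l} (hij : i ≠ j) :
    (volume : Measure (Fin l → I)) {x | x i = x j} = 0 := by
  have hind : iIndepFun (fun (i : Fin l) (x : Fin l → I) => x i) (volume : Measure (Fin l → I)) :=
    iIndepFun_pi (X := fun _ x => x) fun i => aemeasurable_id
  have h := (indepFun_iff_map_prod_eq_prod_map_map (measurable_pi_apply i).aemeasurable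
    (measurable_pi_apply j).aemeasurable).1 (hind.indepFun hij)
  have hm : MeasurableSet {p : I × I | p.1 = p.2} := measurableSet_eq_fun measurable_fst measurable_snd
  have hmap : ∀ i, (volume : Measure (Fin l → I)).map (fun x => x i) = volume := fun i =>
    (measurePreserving_eval (fun _ : Fin l => (volume : Measure I)) i).map_eq
  have : {x : Fin l → I | x i = x j} = (fun x => (x i, x j)) ⁻¹' {p : I × I | p.1 = p.2} := rfl
  rw [this, ← Measure.map_apply ((measurable_pi_apply i).prodMk (measurable_pi_apply j)) hm, h,
    hmap i, hmap j, Measure.measure_prod_null hm]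
  refine ae_of_all _ fun x => ?_
  have : Prod.mk x ⁻¹' {p : I × I | p.1 = p.2} = {x} := by ext; simp [eq_comm]
  simp [this]

variable [TopologicalSpace A] [DiscreteTopology A]

/-- The set is open, and relaxing `StrictMono` to `Monotone` gives a closed superset; a weakly but
not strictly increasing tuple has a tie. -/
lemma frontier_spellingSet_subset {l : ℕ} (u : Word A l) :
    frontier (spellingSet u) ⊆
      ⋃ (i) (j) (_ : i ≠ j), (fun z i => (z i).1) ⁻¹' {x : Fin l → I | x i = x j} := by
  have hopen : IsOpen (spellingSet u) := by
    refine ((isOpen_setOf_strictMono l).preimage (f := fun (z : Fin l → I × A) i => (z i).1) (by fun_prop)).inter ?_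
    have : {z : Fin l → I × A | ∀ i, (z i).2 = u i} = ⋂ i, {z | (z i).2 ∈ ({u i} : Set A)} := by
      ext; simp
    change IsOpen {z : Fin l → I × A | ∀ i, (z i).2 = u i}
    rw [this]
    exact isOpen_iInter_of_finite fun i => (isOpen_discrete {u i}).preimage (by fun_prop)
  have hclosed : IsClosed {z : Fin l → I × A | Monotone (fun i => (z i).1) ∧ ∀ i, (z i).2 = u i} := by
    have : {z : Fin l → I × A | Monotone (fun i => (z i).1) ∧ ∀ i, (z i).2 = u i} =
      (⋂ (i) (j) (_ : i ≤ j), {z | (z i).1 ≤ (z j).1}) ∩ ⋂ i, {z | (z i).2 ∈ ({u i} : Set A)} := by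
      ext; simp [Monotone]
    rw [this]
    refine IsClosed.inter (isClosed_iInter fun i => isClosed_iInter fun j => isClosed_iInter fun _ =>
      isClosed_le (by fun_prop) (by fun_prop)) (isClosed_iInter fun i =>
        (isClosed_discrete {u i}).preimage (by fun_prop))
  intro z hz
  rw [hopen.frontier_eq] at hz
  have hz1 := closure_minimal (t := {z : Fin l → I × A | Monotone (fun i => (z i).1) ∧ ∀ i, (z i).2 = u i})
    (fun z hz => ⟨hz.1.monotone, hz.2⟩) hclosed hz.1
  by_contra hcon
  simp only [mem_iUnion, mem_preimage, mem_ofPred_eq, not_exists] at hcon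
  exact hz.2 ⟨hz1.1.strictMono_of_injective fun i j hij => by_contra fun h => hcon i j h hij, hz1.2⟩

end SpellingSet

/-! ### Limit densities as product measures of spelling sets. -/

section Density

variable {A : Type*} [Fintype A] [MeasurableSpace A] [DiscreteMeasurableSpace A] {f : A → I → I}

lemma pi_letterMeasure_map_fst (hf : IsLimitTuple f) (l : ℕ) :
    (Measure.pi fun _ : Fin l => letterMeasure f).map (fun z i => (z i).1) = volume := by
  have := isProbabilityMeasure_letterMeasure hf
  have h1 : ∀ _ : Fin l, SigmaFinite ((letterMeasure f).map Prod.fst) := by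
    rw [letterMeasure_map_fst hf]; infer_instance
  rw [Measure.pi_map_pi (f := fun _ => Prod.fst) fun _ => measurable_fst.aemeasurable]
  simp_rw [letterMeasure_map_fst hf]
  rfl

lemma pi_letterMeasure_frontier_spellingSet [TopologicalSpace A] [DiscreteTopology A]
    (hf : IsLimitTuple f) {l : ℕ} (u : Word A l) :
    (Measure.pi fun _ : Fin l => letterMeasure f) (frontier (spellingSet u)) = 0 := by
  refine measure_mono_null (frontier_spellingSet_subset u) ?_
  simp only [measure_iUnion_null_iff]
  intro i j hij
  rw [← Measure.map_apply (by fun_prop)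
    (measurableSet_eq_fun (measurable_pi_apply i) (measurable_pi_apply j)),
    pi_letterMeasure_map_fst hf, volume_setOf_apply_eq hij]

lemma letterMeasure_restrict (f : A → I → I) (hf : IsLimitTuple f) (a : A) :
    (letterMeasure f).restrict (univ ×ˢ {a}) =
      (volume.withDensity fun x => ENNReal.ofReal (f a x : ℝ)).map fun x => (x, a) := by
  classical
  have := isProbabilityMeasure_letterMeasure hf
  have hmeas : Measurable fun x : I => (x, a) := measurable_id.prodMk measurable_const
  refine measure_ext_singleton fun B b hB => ?_
  rw [Measure.restrict_apply (hB.prod (measurableSet_singleton b)),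
    Measure.map_apply hmeas (hB.prod (measurableSet_singleton b)), prod_inter_prod, inter_univ]
  by_cases hab : a = b
  · subst hab
    have : (fun x : I => (x, a)) ⁻¹' (B ×ˢ {a}) = B := by ext; simp
    rw [inter_self, this, letterMeasure_prod_singleton f hB, withDensity_apply _ hB]
  · have h1 : (fun x : I => (x, a)) ⁻¹' (B ×ˢ {b}) = ∅ := by ext; simp [hab]
    have h2 : ({b} : Set A) ∩ {a} = ∅ := by ext; simp; grind
    simp [h1, h2]

/-- The integral of `∏ i, f^{u_i}(x_i)` over the simplex, as an extended nonnegative number. -/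
noncomputable def simplexLIntegral {A : Type*} {l : ℕ} (u : Word A l) (f : A → I → I) : ℝ≥0∞ :=
  ∫⁻ x in {x : Fin l → I | StrictMono x}, ∏ i, ENNReal.ofReal (f (u i) (x i) : ℝ)

lemma isFiniteMeasure_withDensity_ofReal (g : I → I) :
    IsFiniteMeasure ((volume : Measure I).withDensity fun x => ENNReal.ofReal (g x : ℝ)) := by
  refine isFiniteMeasure_withDensity (ne_of_lt ?_)
  calc ∫⁻ x, ENNReal.ofReal (g x : ℝ) ≤ ∫⁻ _ : I, 1 :=
        lintegral_mono fun x => ENNReal.ofReal_le_one.2 (g x).2.2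
    _ < ⊤ := by simp

lemma measurableSet_spellingSet {l : ℕ} (u : Word A l) : MeasurableSet (spellingSet u) := by
  refine ((measurableSet_setOf_strictMono l).preimage
    (f := fun (z : Fin l → I × A) i => (z i).1) (by fun_prop)).inter ?_
  change MeasurableSet {z : Fin l → I × A | ∀ i, (z i).2 = u i}
  have : {z : Fin l → I × A | ∀ i, (z i).2 = u i} = ⋂ i, {z | (z i).2 ∈ ({u i} : Set A)} := by
    ext; simp
  rw [this]
  exact MeasurableSet.iInter fun i => (measurableSet_singleton (u i)).preimage (by fun_prop)

/-- The condition on the letters is a box, so restricting to it restricts each factor, leaving the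
density `f (u i)` on the `i`-th position; `pi_withDensity` multiplies these densities. -/
lemma pi_letterMeasure_spellingSet (hf : IsLimitTuple f) {l : ℕ} (u : Word A l) :
    (Measure.pi fun _ : Fin l => letterMeasure f) (spellingSet u) = simplexLIntegral u f := by
  have := isProbabilityMeasure_letterMeasure hf
  have hfin := fun i => isFiniteMeasure_withDensity_ofReal (f (u i))
  have hmap : ∀ i, SigmaFinite ((volume.withDensity fun x => ENNReal.ofReal (f (u i) x : ℝ)).map
      fun x => (x, u i)) := fun i => by infer_instance
  have h1 : spellingSet u = {z | StrictMono fun i => (z i).1} ∩ univ.pi fun i => univ ×ˢ {u i} := by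
    ext z; simp [spellingSet]
  have hm : MeasurableSet {z : Fin l → I × A | StrictMono fun i => (z i).1} :=
    (measurableSet_setOf_strictMono l).preimage
      (f := fun (z : Fin l → I × A) i => (z i).1) (by fun_prop)
  rw [h1, ← Measure.restrict_apply hm, Measure.restrict_pi_pi]
  simp_rw [letterMeasure_restrict f hf]
  rw [← Measure.pi_map_pi (f := fun i x => (x, u i)) (fun i => by fun_prop),
    Measure.map_apply (by fun_prop) hm,
    pi_withDensity _ _ fun i => hf.aemeasurable_ofReal (u i)]
  exact withDensity_apply _ (measurableSet_setOf_strictMono l)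

lemma simplexLIntegral_ne_top (hf : IsLimitTuple f) {l : ℕ} (u : Word A l) :
    simplexLIntegral u f ≠ ⊤ := by
  have := isProbabilityMeasure_letterMeasure hf
  rw [← pi_letterMeasure_spellingSet hf]
  exact measure_ne_top _ _

lemma limitDensity_eq {A : Type*} [Fintype A] {f : A → I → I} (hf : IsLimitTuple f) {l : ℕ} (u : Word A l) :
    limitDensity u f = l.factorial * (simplexLIntegral u f).toReal := by
  rw [limitDensity, simplexLIntegral, integral_eq_lintegral_of_nonneg_ae]
  · simp_rw [ENNReal.ofReal_prod_of_nonneg fun i _ => (f (u i) _).2.1]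
  · exact ae_of_all _ fun x => Finset.prod_nonneg fun i _ => (f (u i) (x i)).2.1
  · refine AEMeasurable.aestronglyMeasurable (AEMeasurable.restrict ?_)
    refine Finset.aemeasurable_fun_prod _ fun i _ => ?_
    exact measurable_subtype_coe.comp_aemeasurable ((hf.aemeasurable (u i)).comp_quasiMeasurePreserving
      (Measure.quasiMeasurePreserving_eval (μ := fun _ => volume) i))

end Density

/-! ### Empirical measures and their powers. -/

section Empirical

variable {E : Type*} [MeasurableSpace E]

/-- The uniform probability measure on the points `z 0, …, z (n - 1)` if `0 < n`, and the zero
measure if `n = 0`. -/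
noncomputable def empiricalMeasure {n : ℕ} (z : Fin n → E) : Measure E :=
  ((n : ℝ≥0∞)⁻¹ • Measure.count).map z

lemma isProbabilityMeasure_empiricalMeasure {n : ℕ} (hn : n ≠ 0) (z : Fin n → E) :
    IsProbabilityMeasure (empiricalMeasure z) := by
  constructor
  rw [empiricalMeasure, Measure.map_apply (measurable_of_finite z) MeasurableSet.univ]
  simp only [preimage_univ, Measure.smul_apply, smul_eq_mul, Measure.count_univ,
    ENat.card_eq_coe_fintype_card, Fintype.card_fin]
  exact ENNReal.inv_mul_cancel (by simpa using hn) (by simp)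

/-- The empirical measure as a probability measure, with a default value for `n = 0`. -/
noncomputable def empirical (μ : ProbabilityMeasure E) {n : ℕ} (z : Fin n → E) :
    ProbabilityMeasure E :=
  if hn : n ≠ 0 then ⟨empiricalMeasure z, isProbabilityMeasure_empiricalMeasure hn z⟩ else μ

lemma toMeasure_empirical (μ : ProbabilityMeasure E) {n : ℕ} (hn : n ≠ 0) (z : Fin n → E) :
    (empirical μ z : Measure E) = empiricalMeasure z :=
  congrArg ProbabilityMeasure.toMeasure (dif_pos hn)

lemma empiricalMeasure_apply {n : ℕ} (z : Fin n → E) {S : Set E} (hS : MeasurableSet S) :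
    empiricalMeasure z S = (n : ℝ≥0∞)⁻¹ * Nat.card {j // z j ∈ S} := by
  rw [empiricalMeasure, Measure.map_apply (measurable_of_finite z) hS, Measure.smul_apply,
    smul_eq_mul, Measure.count_apply_finite _ (toFinite _), ← Nat.card_eq_card_finite_toFinset]
  rfl

lemma integral_empiricalMeasure {n : ℕ} (z : Fin n → E) {φ : E → ℝ} (hφ : StronglyMeasurable φ) :
    ∫ x, φ x ∂empiricalMeasure z = (∑ j, φ (z j)) / n := by
  rw [empiricalMeasure, integral_map (measurable_of_finite z).aemeasurable hφ.aestronglyMeasurable,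
    integral_smul_measure, integral_count]
  simp [div_eq_inv_mul]

lemma pi_empiricalMeasure_apply (l : ℕ) {n : ℕ} (hn : n ≠ 0) (z : Fin n → E)
    {S : Set (Fin l → E)} (hS : MeasurableSet S) :
    (Measure.pi fun _ : Fin l => empiricalMeasure z) S =
      ((n : ℝ≥0∞)⁻¹) ^ l * Nat.card {e : Fin l → Fin n // (fun i => z (e i)) ∈ S} := by
  have hz := isProbabilityMeasure_empiricalMeasure hn z
  have hfin : IsFiniteMeasure ((n : ℝ≥0∞)⁻¹ • (Measure.count : Measure (Fin n))) :=
    ⟨by simpa using ENNReal.mul_lt_top (by simpa [pos_iff_ne_zero] using hn) (by simp)⟩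
  have hpi : (Measure.pi fun _ : Fin l => (n : ℝ≥0∞)⁻¹ • (Measure.count : Measure (Fin n))) =
      ((n : ℝ≥0∞)⁻¹) ^ l • Measure.count := by
    refine Measure.ext_of_singleton fun e => ?_
    simp
  unfold empiricalMeasure at hz ⊢
  rw [← Measure.pi_map_pi (f := fun _ => z) fun _ => (measurable_of_finite z).aemeasurable,
    Measure.map_apply (measurable_of_finite _) hS, hpi, Measure.smul_apply,
    smul_eq_mul, Measure.count_apply_finite _ (toFinite _), ← Nat.card_eq_card_finite_toFinset]
  rfl

end Empirical

/-! ### From weak convergence to convergence of densities. -/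

section Occurrences

variable {A : Type*}

/-- The bijection is `e ↦ τ.symm ∘ e`: with distinct positions, increasing position means increasing
index after sorting by `τ`. -/
lemma card_mem_spellingSet {l n : ℕ} (u : Word A l) (z : Fin n → I × A) (τ : Equiv.Perm (Fin n))
    (hmono : Monotone fun j => (z (τ j)).1) (hinj : Function.Injective fun j => (z j).1) :
    Nat.card {e : Fin l → Fin n // (fun i => z (e i)) ∈ spellingSet u} =
      occurrences u fun j => (z (τ j)).2 := by
  have hstrict : StrictMono fun j => (z (τ j)).1 :=
    hmono.strictMono_of_injective (hinj.comp τ.injective)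
  refine Nat.card_congr
    { toFun := fun e => ⟨OrderEmbedding.ofStrictMono (fun i => τ.symm (e.1 i)) ?_, ?_⟩
      invFun := fun e => ⟨fun i => τ (e.1 i), ?_, ?_⟩
      left_inv := ?_
      right_inv := ?_ }
  · intro i j hij
    refine hstrict.lt_iff_lt.1 ?_
    simpa using e.2.1 hij
  · intro j
    change (z (τ (τ.symm (e.1 j)))).2 = u j
    rw [τ.apply_symm_apply]
    exact e.2.2 j
  · exact fun i j hij => hstrict (e.1.strictMono hij)
  · exact e.2
  · exact fun e => Subtype.ext (funext fun i => τ.apply_symm_apply _)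
  · exact fun e => Subtype.ext (RelEmbedding.ext fun i => τ.symm_apply_apply _)

variable [Fintype A] [MeasurableSpace A] [DiscreteMeasurableSpace A] [TopologicalSpace A]
  [DiscreteTopology A] {f : A → I → I}

lemma tendsto_pow_div_choose (l : ℕ) :
    Tendsto (fun n : ℕ => (n : ℝ) ^ l / n.choose l) atTop (𝓝 l.factorial) := by
  have hne : ∀ᶠ n : ℕ in atTop, (n.choose l : ℝ) ≠ 0 := by
    filter_upwards [eventually_ge_atTop l] with n hn
    exact_mod_cast (Nat.choose_pos hn).ne'
  have h1 : Tendsto (fun n : ℕ => (n : ℝ) ^ l / l.factorial / n.choose l) atTop (𝓝 1) :=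
    (Asymptotics.isEquivalent_iff_tendsto_one hne).1 (isEquivalent_choose l).symm
  have h2 := h1.const_mul (l.factorial : ℝ)
  rw [mul_one] at h2
  refine h2.congr fun n => ?_
  field_simp

/-- The portmanteau theorem for the `l`-fold product measures. The filter is arbitrary because the
lemma serves both `atTop` (random words) and an ultrafilter (compactness). -/
lemma tendsto_density_of_tendsto_empirical (hf : IsLimitTuple f) {ι : Type*} {F : Filter ι}
    {len : ι → ℕ} (hlen : Tendsto len F atTop) (z : ∀ i, Fin (len i) → I × A)
    (τ : ∀ i, Equiv.Perm (Fin (len i))) (hmono : ∀ i, Monotone fun j => (z i (τ i j)).1)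
    (hinj : ∀ i, Function.Injective fun j => (z i j).1)
    {ν : ι → ProbabilityMeasure (I × A)} {μ : ProbabilityMeasure (I × A)}
    (hμ : (μ : Measure (I × A)) = letterMeasure f)
    (hν : ∀ᶠ i in F, (ν i : Measure (I × A)) = empiricalMeasure (z i)) (hlim : Tendsto ν F (𝓝 μ))
    {l : ℕ} (u : Word A l) :
    Tendsto (fun i => density u fun j => (z i (τ i j)).2) F (𝓝 (limitDensity u f)) := by
  have hpi : Tendsto (fun i => ProbabilityMeasure.pi fun _ : Fin l => ν i) F
      (𝓝 (ProbabilityMeasure.pi fun _ : Fin l => μ)) :=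
    (ProbabilityMeasure.continuous_pi.tendsto _).comp (tendsto_pi_nhds.2 fun _ => hlim)
  have hS := ProbabilityMeasure.tendsto_measure_of_null_frontier_of_tendsto' hpi
    (E := spellingSet u) (by
      rw [ProbabilityMeasure.toMeasure_pi, hμ]
      exact pi_letterMeasure_frontier_spellingSet hf u)
  have hS' := (ENNReal.tendsto_toReal (measure_ne_top _ _)).comp hS
  have h2 := hS'.mul ((tendsto_pow_div_choose l).comp hlen)
  rw [ProbabilityMeasure.toMeasure_pi, hμ, pi_letterMeasure_spellingSet hf, mul_comm,
    ← limitDensity_eq hf] at h2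
  refine h2.congr' ?_
  filter_upwards [hν, hlen.eventually_ge_atTop 1] with i hi hn
  have hn0 : len i ≠ 0 := by omega
  have hn0' : (len i : ℝ) ≠ 0 := by exact_mod_cast hn0
  simp only [Function.comp, ProbabilityMeasure.toMeasure_pi, hi]
  rw [pi_empiricalMeasure_apply l hn0 _ (measurableSet_spellingSet u),
    card_mem_spellingSet u (z i) (τ i) (hmono i) (hinj i), density]
  simp only [ENNReal.toReal_mul, ENNReal.toReal_pow, ENNReal.toReal_inv, ENNReal.toReal_natCast, inv_pow]
  field_simp

end Occurrences

/-! ### Almost sure convergence of empirical measures. -/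

section StrongLaw

variable {E Ω : Type*} [MeasurableSpace E] [MeasurableSpace Ω] {P : Measure Ω}
  [IsProbabilityMeasure P] {μ : Measure E} {Z : ∀ n : ℕ, Fin n → Ω → E}

/-- Hoeffding's bound is exponentially small in `n`, hence summable, and this half of Borel-Cantelli
needs no independence between rows. -/
lemma ae_eventually_sum_sub_lt (hZ : ∀ n j, Measurable (Z n j)) (hlaw : ∀ n j, P.map (Z n j) = μ)
    (hind : ∀ n, iIndepFun (Z n) P) {φ : E → ℝ} (hφ : Measurable φ) {M : ℝ} (hM : 0 < M)
    (hbound : ∀ x, |φ x| ≤ M) {ε : ℝ} (hε : 0 < ε) :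
    ∀ᵐ ω ∂P, ∀ᶠ n : ℕ in atTop, ∑ j, (φ (Z n j ω) - ∫ x, φ x ∂μ) < n * ε := by
  -- Hoeffding's variance proxy for values in `[-M, M]`.
  set c : ℝ≥0 := (‖M - -M‖₊ / 2) ^ 2 with hc
  have hc0 : (0 : ℝ) < c := by
    have : 0 < ‖M - -M‖₊ := nnnorm_pos.2 (by linarith)
    exact NNReal.coe_pos.2 (by positivity)
  have hsub : ∀ n j, HasSubgaussianMGF (fun ω => φ (Z n j ω) - ∫ x, φ x ∂μ) c P := by
    intro n j
    have h := hasSubgaussianMGF_of_mem_Icc (μ := P) (X := fun ω => φ (Z n j ω)) (a := -M) (b := M)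
      (hφ.comp (hZ n j)).aemeasurable (ae_of_all _ fun ω => abs_le.1 (hbound _))
    rwa [← integral_map (hZ n j).aemeasurable hφ.aestronglyMeasurable, hlaw] at h
  have hle : ∀ n : ℕ, P {ω | n * ε ≤ ∑ j, (φ (Z n j ω) - ∫ x, φ x ∂μ)} ≤
      ENNReal.ofReal (Real.exp (n * (-(ε ^ 2 / (2 * c))))) := by
    intro n
    have h := HasSubgaussianMGF.measure_sum_ge_le_of_iIndepFun
      ((hind n).comp (fun _ x => φ x - ∫ x, φ x ∂μ) fun _ => hφ.sub_const _)
      (s := Finset.univ) (c := fun _ => c) (fun j _ => hsub n j) (ε := n * ε) (by positivity)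
    rw [← ofReal_measureReal]
    refine ENNReal.ofReal_le_ofReal (h.trans_eq ?_)
    rcases eq_or_ne n 0 with rfl | hn
    · simp
    · have : (n : ℝ) ≠ 0 := by exact_mod_cast hn
      congr 1
      simp only [Finset.sum_const, Finset.card_univ, Fintype.card_fin, nsmul_eq_mul, NNReal.coe_mul,
        NNReal.coe_natCast]
      field_simp
  have hsum : ∑' n : ℕ, P {ω | n * ε ≤ ∑ j, (φ (Z n j ω) - ∫ x, φ x ∂μ)} ≠ ⊤ := by
    have hs : Summable fun n : ℕ => Real.exp (n * (-(ε ^ 2 / (2 * c)))) :=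
      Real.summable_exp_nat_mul_iff.2 (by rw [neg_lt_zero]; positivity)
    exact ne_top_of_le_ne_top hs.tsum_ofReal_ne_top (ENNReal.tsum_le_tsum hle)
  filter_upwards [ae_eventually_notMem hsum] with ω hω
  filter_upwards [hω] with n hn
  exact not_le.1 hn

/-- The strong law of large numbers for a triangular array of bounded functions of independent
identically distributed random variables. -/
lemma ae_tendsto_average (hZ : ∀ n j, Measurable (Z n j)) (hlaw : ∀ n j, P.map (Z n j) = μ)
    (hind : ∀ n, iIndepFun (Z n) P) {φ : E → ℝ} (hφ : Measurable φ) {M : ℝ}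
    (hbound : ∀ x, |φ x| ≤ M) :
    ∀ᵐ ω ∂P, Tendsto (fun n : ℕ => (∑ j, φ (Z n j ω)) / n) atTop (𝓝 (∫ x, φ x ∂μ)) := by
  have hbound' : ∀ x, |φ x| ≤ |M| + 1 := fun x =>
    (hbound x).trans ((le_abs_self M).trans (le_add_of_nonneg_right zero_le_one))
  have hpos : 0 < |M| + 1 := by positivity
  have hup : ∀ᵐ ω ∂P, ∀ k : ℕ, ∀ᶠ n : ℕ in atTop,
      ∑ j, (φ (Z n j ω) - ∫ x, φ x ∂μ) < n * (1 / ((k : ℝ) + 1)) :=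
    ae_all_iff.2 fun k => ae_eventually_sum_sub_lt hZ hlaw hind hφ hpos hbound' (by positivity)
  have hlow : ∀ᵐ ω ∂P, ∀ k : ℕ, ∀ᶠ n : ℕ in atTop,
      ∑ j, (-φ (Z n j ω) - ∫ x, -φ x ∂μ) < n * (1 / ((k : ℝ) + 1)) :=
    ae_all_iff.2 fun k => ae_eventually_sum_sub_lt hZ hlaw hind hφ.neg hpos
      (fun x => by simpa using hbound' x) (by positivity)
  filter_upwards [hup, hlow] with ω h1 h2
  rw [Metric.tendsto_atTop']
  intro ε hε
  obtain ⟨k, hk⟩ := exists_nat_one_div_lt hε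
  obtain ⟨N, hN⟩ := eventually_atTop.1 ((h1 k).and (h2 k))
  refine ⟨N, fun n hn => ?_⟩
  -- Here `hn` is the strict `N < n`, which excludes `n = 0`.
  have hn0 : (0 : ℝ) < n := by exact_mod_cast (Nat.zero_le N).trans_lt hn
  obtain ⟨ha, hb⟩ := hN n hn.le
  simp only [Finset.sum_sub_distrib, Finset.sum_neg_distrib, integral_neg, Finset.sum_const,
    Finset.card_univ, Fintype.card_fin, nsmul_eq_mul] at ha hb
  have hlt : (n : ℝ) * (1 / ((k : ℝ) + 1)) < n * ε := mul_lt_mul_of_pos_left hk hn0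
  rw [Real.dist_eq, abs_lt, sub_lt_iff_lt_add, lt_sub_iff_add_lt, div_lt_iff₀ hn0, lt_div_iff₀ hn0]
  constructor <;> nlinarith

/-- Integration against a probability measure is 1-Lipschitz in the sup norm, uniformly in the
measure, so an `ε / 3` argument applies. -/
lemma tendsto_of_forall_mem_denseRange [TopologicalSpace E] [CompactSpace E] [OpensMeasurableSpace E]
    {ι κ : Type*} {F : Filter ι} {ν : ι → ProbabilityMeasure E} {μ : ProbabilityMeasure E}
    {ψ : κ → C(E, ℝ)} (hψ : DenseRange ψ)
    (h : ∀ k, Tendsto (fun i => ∫ x, ψ k x ∂(ν i : Measure E)) F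
      (𝓝 (∫ x, ψ k x ∂(μ : Measure E)))) : Tendsto ν F (𝓝 μ) := by
  have hint : ∀ (ρ : ProbabilityMeasure E) (φ : C(E, ℝ)), Integrable φ (ρ : Measure E) := fun ρ φ =>
    (BoundedContinuousFunction.mkOfCompact φ).integrable _
  have hdist : ∀ (ρ : ProbabilityMeasure E) (φ χ : C(E, ℝ)),
      dist (∫ x, φ x ∂(ρ : Measure E)) (∫ x, χ x ∂(ρ : Measure E)) ≤ dist φ χ := by
    intro ρ φ χ
    rw [dist_eq_norm, ← integral_sub (hint ρ φ) (hint ρ χ)]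
    refine (norm_integral_le_of_norm_le_const (C := dist φ χ) (ae_of_all _ fun x => ?_)).trans ?_
    · rw [← dist_eq_norm]
      exact ContinuousMap.dist_apply_le_dist x
    · simp
  rw [ProbabilityMeasure.tendsto_iff_forall_integral_tendsto]
  intro φ
  rw [Metric.tendsto_nhds]
  intro ε hε
  obtain ⟨k, hk⟩ := hψ.exists_dist_lt φ.toContinuousMap (show 0 < ε / 3 by positivity)
  filter_upwards [Metric.tendsto_nhds.1 (h k) (ε / 3) (by positivity)] with i hi
  have h1 := hdist (ν i) φ.toContinuousMap (ψ k)
  have h2 := hdist μ (ψ k) φ.toContinuousMap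
  rw [dist_comm (ψ k)] at h2
  calc _ ≤ _ := dist_triangle4 _ (∫ x, ψ k x ∂(ν i : Measure E)) (∫ x, ψ k x ∂(μ : Measure E)) _
    _ < ε / 3 + ε / 3 + ε / 3 := add_lt_add (add_lt_add (h1.trans_lt hk) hi) (h2.trans_lt hk)
    _ = ε := by ring

lemma ae_tendsto_empirical [TopologicalSpace E] [CompactSpace E] [BorelSpace E]
    [TopologicalSpace.SeparableSpace C(E, ℝ)] {μ : ProbabilityMeasure E}
    (hZ : ∀ n j, Measurable (Z n j)) (hlaw : ∀ n j, P.map (Z n j) = μ)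
    (hind : ∀ n, iIndepFun (Z n) P) :
    ∀ᵐ ω ∂P, Tendsto (fun n => empirical μ fun j => Z n j ω) atTop (𝓝 μ) := by
  have h : ∀ᵐ ω ∂P, ∀ k : ℕ, Tendsto
      (fun n : ℕ => (∑ j, TopologicalSpace.denseSeq C(E, ℝ) k (Z n j ω)) / n) atTop
      (𝓝 (∫ x, TopologicalSpace.denseSeq C(E, ℝ) k x ∂(μ : Measure E))) :=
    ae_all_iff.2 fun k => ae_tendsto_average hZ hlaw hind
      (TopologicalSpace.denseSeq C(E, ℝ) k).continuous.measurable
      fun x => ContinuousMap.norm_coe_le_norm (TopologicalSpace.denseSeq C(E, ℝ) k) x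
  filter_upwards [h] with ω hω
  refine tendsto_of_forall_mem_denseRange (TopologicalSpace.denseRange_denseSeq C(E, ℝ)) fun k => ?_
  refine (hω k).congr' ?_
  filter_upwards [eventually_ne_atTop 0] with n hn
  rw [toMeasure_empirical μ hn, integral_empiricalMeasure _
    (TopologicalSpace.denseSeq C(E, ℝ) k).continuous.measurable.stronglyMeasurable]

end StrongLaw

/-! ### Random words converge almost surely. -/

section RandomWords

variable {A : Type*} [Fintype A] [MeasurableSpace A] [DiscreteMeasurableSpace A] {f : A → I → I}
  {Ω : Type*} [MeasurableSpace Ω] {P : Measure Ω}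

lemma ae_injective_of_iIndepFun [IsProbabilityMeasure P] {n : ℕ} {X : Fin n → Ω → I}
    (hX : ∀ j, Measurable (X j))
    (huniform : ∀ j, P.map (X j) = volume) (hind : iIndepFun X P) :
    ∀ᵐ ω ∂P, Function.Injective fun j => X j ω := by
  have hmap : P.map (fun ω j => X j ω) = volume := by
    rw [(iIndepFun_iff_map_fun_eq_pi_map fun j => (hX j).aemeasurable).1 hind]
    simp_rw [huniform]
    rfl
  have h : ∀ i j, i ≠ j → ∀ᵐ ω ∂P, X i ω ≠ X j ω := by
    intro i j hij
    have h1 := volume_setOf_apply_eq hij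
    rw [← hmap, Measure.map_apply (measurable_pi_lambda _ hX)
      (measurableSet_eq_fun (measurable_pi_apply i) (measurable_pi_apply j))] at h1
    exact measure_eq_zero_iff_ae_notMem.1 h1
  filter_upwards [ae_all_iff.2 fun i => ae_all_iff.2 fun j => ae_all_iff.2 fun hij => h i j hij]
    with ω hω i j hij
  exact by_contra fun hne => hω i j hne hij

theorem ae_convergesTo_of_isRandomWord [IsProbabilityMeasure P] (hf : IsLimitTuple f)
    {W : ∀ n, Ω → Word A n}
    (hW : ∀ n, IsRandomWord P f n (W n)) : ∀ᵐ ω ∂P, ConvergesTo (fun n => W n ω) f := by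
  let _ : TopologicalSpace A := ⊥
  have : DiscreteTopology A := ⟨rfl⟩
  choose X Y τ hletter hind hmono hWeq using hW
  have := isProbabilityMeasure_letterMeasure hf
  let μ : ProbabilityMeasure (I × A) := ⟨letterMeasure f, inferInstance⟩
  have hinj : ∀ᵐ ω ∂P, ∀ n, Function.Injective fun j => X n j ω :=
    ae_all_iff.2 fun n => ae_injective_of_iIndepFun (fun j => (hletter n j).measurable_fst)
      (fun j => (hletter n j).uniform) ((hind n).comp (fun _ => Prod.fst) fun _ => measurable_fst)
  have hemp := ae_tendsto_empirical (P := P) (μ := μ) (Z := fun n j ω => (X n j ω, Y n j ω))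
    (fun n j => (hletter n j).measurable_fst.prodMk (hletter n j).measurable_snd)
    (fun n j => (hletter n j).map_eq) hind
  filter_upwards [hinj, hemp] with ω h1 h2 l u
  have h3 := tendsto_density_of_tendsto_empirical hf tendsto_id (fun n j => (X n j ω, Y n j ω))
    (fun n => τ n ω) (fun n => hmono n ω) h1 (μ := μ) rfl
    ((eventually_ne_atTop 0).mono fun n hn => toMeasure_empirical μ hn _) h2 u
  refine h3.congr fun n => ?_
  congr 1
  funext j
  exact (hWeq n ω j).symm

lemma exists_isRandomWord (hf : IsLimitTuple f) (n : ℕ) {Z : ℕ → Ω → I × A}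
    (hZ : ∀ j, Measurable (Z j)) (hlaw : ∀ j, P.map (Z j) = letterMeasure f)
    (hind : iIndepFun Z P) : ∃ W : Ω → Word A n, IsRandomWord P f n W :=
  ⟨fun ω j => (Z (Tuple.sort (fun j : Fin n => (Z j ω).1) j) ω).2,
    fun j ω => (Z j ω).1, fun j ω => (Z j ω).2, fun ω => Tuple.sort fun j : Fin n => (Z j ω).1,
    fun j => isRandomLetter_of_map_eq hf (hZ j) (hlaw j),
    hind.precomp Fin.val_injective,
    fun ω => Tuple.monotone_sort fun j : Fin n => (Z j ω).1,
    fun _ _ => rfl⟩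

theorem exists_convergesTo (hf : IsLimitTuple f) :
    ∃ w : ∀ n, Word A n, ConvergesTo w f := by
  have := isProbabilityMeasure_letterMeasure hf
  -- One i.i.d. sequence of letters supplies the random words of every length.
  let P : Measure (ℕ → I × A) := Measure.infinitePi fun _ => letterMeasure f
  have hind : iIndepFun (fun j (ω : ℕ → I × A) => ω j) P :=
    iIndepFun_infinitePi (X := fun _ x => x) fun _ => measurable_id
  choose W hW using fun n => exists_isRandomWord (P := P) hf n (Z := fun j ω => ω j)
    (fun j => measurable_pi_apply j) (fun j => (measurePreserving_eval_infinitePi _ j).map_eq) hind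
  obtain ⟨ω, hω⟩ := (ae_convergesTo_of_isRandomWord hf hW).exists
  exact ⟨fun n => W n ω, hω⟩

end RandomWords

/-! ### Equally spaced positions. -/

section Grid

/-- The point `j / n` of the unit interval. -/
noncomputable def gridPoint {n : ℕ} (j : Fin n) : I :=
  ⟨(j : ℝ) / n, by positivity, div_le_one_of_le₀ (by exact_mod_cast j.2.le) (by positivity)⟩

lemma strictMono_gridPoint {n : ℕ} : StrictMono (gridPoint : Fin n → I) := by
  intro i j hij
  have hn : (0 : ℝ) < n := by exact_mod_cast i.pos
  exact Subtype.mk_lt_mk.2 ((div_lt_div_iff_of_pos_right hn).2 (by exact_mod_cast hij))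

lemma card_gridPoint_lt_le (n : ℕ) (t : I) :
    (Nat.card {j : Fin n // gridPoint j < t} : ℝ) ≤ n * (t : ℝ) + 1 := by
  have hlt : ∀ j : {j : Fin n // gridPoint j < t}, ((j.1 : ℕ) : ℝ) < n * (t : ℝ) := fun j => by
    have hn : (0 : ℝ) < n := by exact_mod_cast j.1.pos
    have := Subtype.coe_lt_coe.2 j.2
    rw [gridPoint, div_lt_iff₀ hn] at this
    linarith
  have h : Nat.card {j : Fin n // gridPoint j < t} ≤ Nat.card (Fin ⌈n * (t : ℝ)⌉₊) :=
    Nat.card_le_card_of_injective (fun j => ⟨j.1, Nat.lt_ceil.2 (hlt j)⟩) fun i j hij =>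
      Subtype.ext (Fin.ext (Fin.mk.inj_iff.1 hij))
  rw [Nat.card_fin] at h
  calc (Nat.card {j : Fin n // gridPoint j < t} : ℝ) ≤ ⌈n * (t : ℝ)⌉₊ := by exact_mod_cast h
    _ ≤ n * (t : ℝ) + 1 := (Nat.ceil_lt_add_one (mul_nonneg n.cast_nonneg t.2.1)).le

lemma le_card_gridPoint_le (n : ℕ) (t : I) :
    n * (t : ℝ) ≤ Nat.card {j : Fin n // gridPoint j ≤ t} := by
  have h : Nat.card (Fin (min n (⌊n * (t : ℝ)⌋₊ + 1))) ≤ Nat.card {j : Fin n // gridPoint j ≤ t} := by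
    refine Nat.card_le_card_of_injective
      (fun i => ⟨⟨i, i.2.trans_le (min_le_left _ _)⟩, ?_⟩) fun i j hij => ?_
    · have hi : (i : ℕ) ≤ ⌊n * (t : ℝ)⌋₊ := Nat.lt_succ_iff.1 (i.2.trans_le (min_le_right _ _))
      have hn : (0 : ℝ) < n := by exact_mod_cast i.pos.trans_le (min_le_left _ _)
      have := (Nat.le_floor_iff (mul_nonneg n.cast_nonneg t.2.1)).1 hi
      refine Subtype.coe_le_coe.1 ?_
      rw [gridPoint, div_le_iff₀ hn]
      simpa [mul_comm] using this
    · simpa [Fin.ext_iff] using hij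
  rw [Nat.card_fin] at h
  refine le_trans ?_ (Nat.cast_le.2 h)
  rw [Nat.cast_min, Nat.cast_add_one]
  exact le_min (mul_le_of_le_one_right n.cast_nonneg t.2.2) (Nat.lt_floor_add_one _).le

end Grid

/-! ### Existence of a limit tuple. -/

section Compactness

variable {A : Type*} [Fintype A] [MeasurableSpace A] [DiscreteMeasurableSpace A]

/-- Portmanteau bounds open sets from above and closed sets from below, so the grid counts control
`Iio t` and `Iic t` respectively. -/
lemma map_fst_eq_volume_of_tendsto [TopologicalSpace A] [DiscreteTopology A]
    {ι : Type*} {F : Filter ι} [NeBot F] {len : ι → ℕ}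
    (hlen : Tendsto len F atTop) (w : ∀ i, Word A (len i)) {ν : ι → ProbabilityMeasure (I × A)}
    {μ : ProbabilityMeasure (I × A)}
    (hν : ∀ᶠ i in F, (ν i : Measure (I × A)) = empiricalMeasure fun j => (gridPoint j, w i j))
    (hlim : Tendsto ν F (𝓝 μ)) : (μ : Measure (I × A)).map Prod.fst = volume := by
  have hupper : ∀ t : I, (μ : Measure (I × A)) (Prod.fst ⁻¹' Iio t) ≤ ENNReal.ofReal t := by
    intro t
    refine (ProbabilityMeasure.le_liminf_measure_open_of_tendsto hlim
      (isOpen_Iio.preimage continuous_fst)).trans ?_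
    have ht : Tendsto (fun i => ENNReal.ofReal ((t : ℝ) + ((len i : ℕ) : ℝ)⁻¹)) F
        (𝓝 (ENNReal.ofReal t)) := by
      refine (ENNReal.continuous_ofReal.tendsto _).comp ?_
      simpa using ((tendsto_inv_atTop_nhds_zero_nat (𝕜 := ℝ)).comp hlen).const_add (t : ℝ)
    rw [← ht.liminf_eq]
    refine liminf_le_liminf ?_
    filter_upwards [hν, hlen.eventually_ge_atTop 1] with i hi hn
    have hn' : (0 : ℝ) < len i := by exact_mod_cast hn
    rw [hi, empiricalMeasure_apply _ (measurableSet_Iio.preimage measurable_fst)]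
    simp only [mem_preimage, mem_Iio]
    rw [← ENNReal.ofReal_natCast, ← ENNReal.ofReal_natCast, ← ENNReal.ofReal_inv_of_pos hn',
      ← ENNReal.ofReal_mul (by positivity)]
    refine ENNReal.ofReal_le_ofReal ?_
    rw [inv_mul_le_iff₀ hn', mul_add, mul_inv_cancel₀ hn'.ne']
    exact card_gridPoint_lt_le _ t
  have hlower : ∀ t : I, ENNReal.ofReal t ≤ (μ : Measure (I × A)) (Prod.fst ⁻¹' Iic t) := by
    intro t
    refine le_trans ?_ (ProbabilityMeasure.limsup_measure_closed_le_of_tendsto hlim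
      (isClosed_Iic.preimage continuous_fst))
    refine le_limsup_of_frequently_le' (Eventually.frequently ?_)
    filter_upwards [hν, hlen.eventually_ge_atTop 1] with i hi hn
    have hn' : (0 : ℝ) < len i := by exact_mod_cast hn
    rw [hi, empiricalMeasure_apply _ (measurableSet_Iic.preimage measurable_fst)]
    simp only [mem_preimage, mem_Iic]
    rw [← ENNReal.ofReal_natCast, ← ENNReal.ofReal_natCast, ← ENNReal.ofReal_inv_of_pos hn',
      ← ENNReal.ofReal_mul (by positivity)]
    refine ENNReal.ofReal_le_ofReal ?_
    rw [le_inv_mul_iff₀ hn']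
    exact le_card_gridPoint_le _ t
  have := Measure.isProbabilityMeasure_map (μ := (μ : Measure (I × A)))
    (measurable_fst (α := I) (β := A)).aemeasurable
  refine Measure.ext_of_Iic _ _ fun t => ?_
  rw [unitInterval.volume_Iic, Measure.map_apply measurable_fst measurableSet_Iic]
  refine le_antisymm ?_ (hlower t)
  -- To bound `Iic t` from above, enlarge it to `Iio c` with `c` slightly above `t`; this needs room
  -- below `1`.
  rcases eq_or_lt_of_le t.2.2 with ht | ht
  · rw [ht, ENNReal.ofReal_one]
    exact prob_le_one
  · refine le_of_forall_gt_imp_ge_of_dense fun c hc => ?_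
    rcases le_or_gt 1 c with h1 | h1
    · exact prob_le_one.trans h1
    · have hc1 : c ≠ ⊤ := (h1.trans ENNReal.one_lt_top).ne
      have hcr : c.toReal ∈ I := ⟨ENNReal.toReal_nonneg,
        by simpa using (ENNReal.toReal_mono ENNReal.one_ne_top h1.le)⟩
      have hlt : t < ⟨c.toReal, hcr⟩ := Subtype.coe_lt_coe.1 <| by
        have := (ENNReal.toReal_lt_toReal ENNReal.ofReal_ne_top hc1).2 hc
        rwa [ENNReal.toReal_ofReal t.2.1] at this
      calc _ ≤ (μ : Measure (I × A)) (Prod.fst ⁻¹' Iio ⟨c.toReal, hcr⟩) :=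
            measure_mono (preimage_mono (Iic_subset_Iio.2 hlt))
        _ ≤ ENNReal.ofReal c.toReal := hupper _
        _ = c := ENNReal.ofReal_toReal hc1

/-- For each letter, the slice of `μ` is dominated by the marginal `volume`; the densities of the
slices sum to `1` almost everywhere. -/
lemma exists_isLimitTuple_letterMeasure_eq {μ : Measure (I × A)} [IsProbabilityMeasure μ]
    (hμ : μ.map Prod.fst = volume) : ∃ f : A → I → I, IsLimitTuple f ∧ letterMeasure f = μ := by
  let ρ : A → Measure I := fun a => (μ.restrict (univ ×ˢ {a})).map Prod.fst
  have hρ_apply : ∀ a {B : Set I}, MeasurableSet B → ρ a B = μ (B ×ˢ {a}) := by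
    intro a B hB
    rw [Measure.map_apply measurable_fst hB, Measure.restrict_apply (hB.preimage measurable_fst)]
    congr 1
    ext ⟨x, b⟩; simp
  have hρ_le : ∀ a, ρ a ≤ volume := fun a => by
    rw [← hμ]
    exact Measure.map_mono Measure.restrict_le_self measurable_fst
  have hρ_fin : ∀ a, IsFiniteMeasure (ρ a) := fun a => by infer_instance
  let d : A → I → ℝ≥0∞ := fun a => (ρ a).rnDeriv volume
  have hd_meas : ∀ a, Measurable (d a) := fun a => Measure.measurable_rnDeriv _ _
  have hd_setLIntegral : ∀ a (B : Set I), ∫⁻ x in B, d a x = ρ a B := fun a B =>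
    Measure.setLIntegral_rnDeriv (Measure.absolutelyContinuous_of_le (hρ_le a)) B
  have hd_sum : (fun x => ∑ a, d a x) =ᵐ[volume] fun _ => 1 := by
    refine ae_eq_of_forall_setLIntegral_eq_of_sigmaFinite
      (Finset.measurable_fun_sum _ fun a _ => hd_meas a) measurable_const fun B hB _ => ?_
    rw [lintegral_finsetSum _ fun a _ => hd_meas a]
    have h1 : (Prod.fst : I × A → I) ⁻¹' B = ⋃ a : A, B ×ˢ ({a} : Set A) := by
      ext ⟨x, a⟩; simp
    have hdisj : Pairwise (Function.onFun Disjoint fun a : A => B ×ˢ ({a} : Set A)) := by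
      intro a b hab
      exact Set.disjoint_prod.2 (Or.inr (by simpa using hab))
    calc ∑ a, ∫⁻ x in B, d a x = ∑ a, μ (B ×ˢ {a}) :=
          Finset.sum_congr rfl fun a _ => by rw [hd_setLIntegral, hρ_apply a hB]
      _ = μ (Prod.fst ⁻¹' B) := by
          rw [h1, measure_iUnion hdisj fun a => hB.prod (measurableSet_singleton a), tsum_fintype]
      _ = ∫⁻ _ in B, 1 := by
          rw [← Measure.map_apply measurable_fst hB, hμ, setLIntegral_one]
  -- The projection only matters on the null set where some density exceeds `1`.
  let f : A → I → I := fun a x => projIcc 0 1 zero_le_one (d a x).toReal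
  have hf_coe : ∀ᵐ x ∂(volume : Measure I), ∀ a, ENNReal.ofReal (f a x : ℝ) = d a x := by
    filter_upwards [hd_sum] with x hx a
    have hle : d a x ≤ 1 := hx ▸ Finset.single_le_sum (f := fun a => d a x)
      (fun _ _ => zero_le) (Finset.mem_univ a)
    have htop : d a x ≠ ⊤ := ne_top_of_le_ne_top ENNReal.one_ne_top hle
    have hmem : (d a x).toReal ∈ Icc (0 : ℝ) 1 := ⟨ENNReal.toReal_nonneg,
      by simpa using ENNReal.toReal_mono ENNReal.one_ne_top hle⟩
    simp only [f, projIcc_of_mem _ hmem, ENNReal.ofReal_toReal htop]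
  have hf : IsLimitTuple f := by
    refine ⟨fun a => (continuous_projIcc.measurable.comp (hd_meas a).ennreal_toReal).aemeasurable, ?_⟩
    filter_upwards [hd_sum, hf_coe] with x hx hfx
    have h1 : ENNReal.ofReal (∑ a, (f a x : ℝ)) = 1 := by
      rw [ENNReal.ofReal_sum_of_nonneg fun a _ => (f a x).2.1, ← hx]
      exact Finset.sum_congr rfl fun a _ => hfx a
    exact ENNReal.ofReal_eq_one.1 h1
  have := isProbabilityMeasure_letterMeasure hf
  refine ⟨f, hf, measure_ext_singleton fun B a hB => ?_⟩
  rw [letterMeasure_prod_singleton f hB, ← hρ_apply a hB, ← hd_setLIntegral]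
  refine lintegral_congr_ae (ae_restrict_of_ae ?_)
  filter_upwards [hf_coe] with x hx using hx a

theorem Convergent.exists_convergesTo {len : ℕ → ℕ} {w : ∀ n, Word A (len n)}
    (hlen : Tendsto len atTop atTop) (hw : Convergent w) :
    ∃ f : A → I → I, IsLimitTuple f ∧ ConvergesTo w f := by
  let _ : TopologicalSpace A := ⊥
  have : DiscreteTopology A := ⟨rfl⟩
  -- `A` is not assumed nonempty; a nonempty word provides a letter for the default measure `μ₀`.
  obtain ⟨N, hN⟩ := (hlen.eventually_ge_atTop 1).exists
  let μ₀ : ProbabilityMeasure (I × A) := ⟨Measure.dirac (0, w N ⟨0, hN⟩), inferInstance⟩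
  let z : ∀ n, Fin (len n) → I × A := fun n j => (gridPoint j, w n j)
  let ν : ℕ → ProbabilityMeasure (I × A) := fun n => empirical μ₀ (z n)
  let F : Filter ℕ := hyperfilter ℕ
  have hF : F ≤ atTop := Nat.hyperfilter_le_atTop
  have hlenF : Tendsto len F atTop := hlen.mono_left hF
  have hν : ∀ᶠ n in F, (ν n : Measure (I × A)) = empiricalMeasure (z n) :=
    (hlenF.eventually_ne_atTop 0).mono fun n hn => toMeasure_empirical μ₀ hn _
  obtain ⟨μ, hμ⟩ : ∃ μ, Tendsto ν F (𝓝 μ) :=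
    ⟨_, ((hyperfilter ℕ).map ν).le_nhds_lim⟩
  obtain ⟨f, hf, hfμ⟩ := exists_isLimitTuple_letterMeasure_eq
    (map_fst_eq_volume_of_tendsto hlenF w hν hμ)
  refine ⟨f, hf, fun l u => ?_⟩
  obtain ⟨c, hc⟩ := hw l u
  have h1 := tendsto_density_of_tendsto_empirical hf hlenF z (fun _ => Equiv.refl _)
    (fun n => strictMono_gridPoint.monotone) (fun n => strictMono_gridPoint.injective)
    hfμ.symm hν hμ u
  rwa [← tendsto_nhds_unique (hc.mono_left hF) h1]

end Compactness

/-! ### Volumes of ordered simplices. -/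

section Simplex

lemma strictMono_snoc_iff {k : ℕ} {y : Fin k → I} {s : I} :
    StrictMono (Fin.snoc y s : Fin (k + 1) → I) ↔ StrictMono y ∧ ∀ i, y i < s := by
  constructor
  · intro h
    refine ⟨fun i j hij => ?_, fun i => ?_⟩
    · simpa using h (Fin.castSucc_lt_castSucc_iff.2 hij)
    · simpa using h (Fin.castSucc_lt_last i)
  · rintro ⟨h1, h2⟩ i j hij
    induction j using Fin.lastCases with
    | last =>
      induction i using Fin.lastCases with
      | last => exact absurd hij (lt_irrefl _)
      | cast i => simpa using h2 i
    | cast j =>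
      induction i using Fin.lastCases with
      | last => exact absurd (hij.trans (Fin.castSucc_lt_last j)) (lt_irrefl _)
      | cast i => simpa using h1 (Fin.castSucc_lt_castSucc_iff.1 hij)

lemma measurableSet_strictMono_lt (k : ℕ) (s : I) :
    MeasurableSet {y : Fin k → I | StrictMono y ∧ ∀ i, y i < s} := by
  refine (measurableSet_setOf_strictMono k).inter ?_
  change MeasurableSet {y : Fin k → I | ∀ i, y i < s}
  have : {y : Fin k → I | ∀ i, y i < s} = ⋂ i, {y | y i < s} := by ext; simp
  rw [this]
  exact MeasurableSet.iInter fun i => measurableSet_lt (measurable_pi_apply i) measurable_const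

/-- Integration over the simplex, with the last coordinate integrated last. -/
lemma setLIntegral_strictMono_last (k : ℕ) {g : I → ℝ≥0∞} (hg : AEMeasurable g volume) :
    ∫⁻ x in {x : Fin (k + 1) → I | StrictMono x}, g (x (Fin.last k)) =
      ∫⁻ s, g s * volume {y : Fin k → I | StrictMono y ∧ ∀ i, y i < s} := by
  let e := MeasurableEquiv.piFinSuccAbove (fun _ : Fin (k + 1) => I) (Fin.last k)
  have he : MeasurePreserving e.symm (volume.prod volume) volume :=
    (volume_preserving_piFinSuccAbove (fun _ : Fin (k + 1) => I) (Fin.last k)).symm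
  have hesymm : ∀ p : I × (Fin k → I), e.symm p = (Fin.snoc p.2 p.1 : Fin (k + 1) → I) := by
    intro p
    exact Fin.insertNth_last' p.1 p.2
  have hF : AEMeasurable ({x : Fin (k + 1) → I | StrictMono x}.indicator
      fun x => g (x (Fin.last k))) volume :=
    (hg.comp_quasiMeasurePreserving (Measure.quasiMeasurePreserving_eval
      (μ := fun _ => volume) (Fin.last k))).indicator (measurableSet_setOf_strictMono _)
  rw [← lintegral_indicator (measurableSet_setOf_strictMono _),
    ← he.lintegral_comp_emb e.symm.measurableEmbedding,
    lintegral_prod (fun p => {x : Fin (k + 1) → I | StrictMono x}.indicator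
      (fun x => g (x (Fin.last k))) (e.symm p))
      (hF.comp_quasiMeasurePreserving he.quasiMeasurePreserving)]
  refine lintegral_congr fun s => ?_
  rw [← setLIntegral_const, ← lintegral_indicator (measurableSet_strictMono_lt k s)]
  refine lintegral_congr fun y => ?_
  simp only [hesymm, indicator, mem_ofPred_eq, strictMono_snoc_iff, Fin.snoc_last]

lemma setLIntegral_Iio_pow (k : ℕ) (t : I) :
    ∫⁻ s in Iio t, ENNReal.ofReal ((s : ℝ) ^ k / k.factorial) =
      ENNReal.ofReal ((t : ℝ) ^ (k + 1) / (k + 1).factorial) := by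
  have h1 : ∫⁻ s in Iio t, ENNReal.ofReal ((s : ℝ) ^ k / k.factorial) =
      ∫⁻ r in Ioc (0 : ℝ) t, ENNReal.ofReal (r ^ k / k.factorial) := by
    rw [← lintegral_indicator measurableSet_Iio, ← lintegral_indicator measurableSet_Ioc]
    have h2 : ∀ᵐ s ∂(volume : Measure I), (Iio t).indicator
        (fun s => ENNReal.ofReal ((s : ℝ) ^ k / k.factorial)) s =
          (Ioc (0 : ℝ) t).indicator (fun r => ENNReal.ofReal (r ^ k / k.factorial)) (s : ℝ) := by
      -- `Iio t` and `Ioc 0 t` differ only at the endpoints `0` and `t`.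
      filter_upwards [Measure.ae_ne volume t, Measure.ae_ne volume (0 : I)] with s hst hs0
      have hpos : 0 < (s : ℝ) := lt_of_le_of_ne s.2.1 fun h => hs0 (Subtype.ext h.symm)
      have : s ∈ Iio t ↔ (s : ℝ) ∈ Ioc (0 : ℝ) t :=
        ⟨fun h => ⟨hpos, Subtype.coe_le_coe.2 (le_of_lt h)⟩,
          fun h => lt_of_le_of_ne (show s ≤ t from h.2) hst⟩
      by_cases hs : s ∈ Iio t
      · rw [indicator_of_mem hs, indicator_of_mem (this.1 hs)]
      · rw [indicator_of_notMem hs, indicator_of_notMem (mt this.2 hs)]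
    rw [lintegral_congr_ae h2, unitInterval.measurePreserving_coe.lintegral_comp
      ((by fun_prop : Measurable fun r : ℝ => ENNReal.ofReal (r ^ k / k.factorial)).indicator
        measurableSet_Ioc), ← lintegral_indicator measurableSet_Icc, indicator_indicator,
      (inter_eq_right.2 fun r hr => ⟨hr.1.le, hr.2.trans t.2.2⟩ : Icc (0 : ℝ) 1 ∩ Ioc (0 : ℝ) t = _)]
  have hint : IntegrableOn (fun r : ℝ => r ^ k / k.factorial) (Ioc 0 t) :=
    ((by fun_prop : Continuous fun r : ℝ => r ^ k / k.factorial).integrableOn_Icc).mono_set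
      Ioc_subset_Icc_self
  rw [h1, ← ofReal_integral_eq_lintegral_ofReal hint ((ae_restrict_iff' measurableSet_Ioc).2
    (ae_of_all _ fun r hr => div_nonneg (pow_nonneg hr.1.le k) (Nat.cast_nonneg _))),
    ← intervalIntegral.integral_of_le t.2.1, intervalIntegral.integral_div, integral_pow]
  congr 1
  rw [Nat.factorial_succ]
  push_cast
  field_simp
  simp

/-- Induction on `k`: fixing the last coordinate at `s < t` leaves the simplex of the previous
dimension below `s`. -/
lemma volume_strictMono_lt (k : ℕ) (t : I) :
    volume {y : Fin k → I | StrictMono y ∧ ∀ i, y i < t} =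
      ENNReal.ofReal ((t : ℝ) ^ k / k.factorial) := by
  induction k generalizing t with
  | zero =>
    have : {y : Fin 0 → I | StrictMono y ∧ ∀ i, y i < t} = univ :=
      eq_univ_of_forall fun y => ⟨fun i => i.elim0, fun i => i.elim0⟩
    rw [this, measure_univ]
    simp
  | succ k ih =>
    have hset : {y : Fin (k + 1) → I | StrictMono y ∧ ∀ i, y i < t} =
        {y | StrictMono y} ∩ {y | y (Fin.last k) < t} := by
      ext y
      exact ⟨fun h => ⟨h.1, h.2 _⟩, fun h => ⟨h.1, fun i => (h.1.monotone (Fin.le_last i)).trans_lt h.2⟩⟩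
    have hm : MeasurableSet {y : Fin (k + 1) → I | y (Fin.last k) < t} :=
      measurableSet_lt (measurable_pi_apply _) measurable_const
    have h := setLIntegral_strictMono_last k (g := (Iio t).indicator fun _ => 1)
      (measurable_const.indicator measurableSet_Iio).aemeasurable
    rw [hset, inter_comm, ← Measure.restrict_apply hm, ← lintegral_indicator_one hm]
    refine Eq.trans ?_ (h.trans ?_)
    · rfl
    · simp_rw [ih]
      rw [← setLIntegral_Iio_pow, ← lintegral_indicator measurableSet_Iio]
      refine lintegral_congr fun s => ?_
      by_cases hs : s ∈ Iio t <;> simp [hs, indicator]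

end Simplex

/-! ### Uniqueness through moments. -/

section Uniqueness

variable {A : Type*} [Fintype A] {f g : A → I → I}

/-- Summing over the first `k` letters replaces their factors by `∏ i, ∑ b, f b (x i) = 1`, leaving
only the volume of the simplex below the last coordinate. -/
lemma sum_simplexLIntegral_snoc (hf : IsLimitTuple f) (k : ℕ) (a : A) :
    ∑ v : Word A k, simplexLIntegral (Fin.snoc v a : Word A (k + 1)) f =
      ∫⁻ s, ENNReal.ofReal (f a s : ℝ) * ENNReal.ofReal ((s : ℝ) ^ k / k.factorial) := by
  have heval : ∀ {l : ℕ} (b : A) (i : Fin l),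
      AEMeasurable (fun x : Fin l → I => ENNReal.ofReal (f b (x i) : ℝ)) volume := fun b i =>
    (hf.aemeasurable_ofReal b).comp_quasiMeasurePreserving
      (Measure.quasiMeasurePreserving_eval (μ := fun _ => volume) i)
  have hsum : ∀ᵐ x ∂(volume : Measure (Fin (k + 1) → I)), ∀ i,
      ∑ b, ENNReal.ofReal (f b (x i) : ℝ) = 1 :=
    ae_all_iff.2 fun i =>
      (Measure.quasiMeasurePreserving_eval (μ := fun _ : Fin (k + 1) => (volume : Measure I)) i).ae
        hf.sum_ofReal
  simp_rw [← volume_strictMono_lt]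
  rw [← setLIntegral_strictMono_last k (hf.aemeasurable_ofReal a)]
  unfold simplexLIntegral
  rw [← lintegral_finsetSum' _ fun v _ =>
    (Finset.aemeasurable_fun_prod _ fun i _ => heval _ i).restrict]
  refine lintegral_congr_ae (ae_restrict_of_ae ?_)
  filter_upwards [hsum] with x hx
  classical
  simp_rw [Fin.prod_univ_castSucc, Fin.snoc_castSucc, Fin.snoc_last]
  rw [← Finset.sum_mul, ← Fintype.prod_sum fun (i : Fin k) b => ENNReal.ofReal (f b (x i.castSucc) : ℝ),
    Finset.prod_eq_one fun i _ => hx _, one_mul]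

/-- Weierstrass: polynomials are dense in `C(I, ℝ)`, and the test functions with equal integrals
form a closed set. -/
lemma measure_eq_of_integral_pow_eq {μ ν : Measure I} [IsFiniteMeasure μ] [IsFiniteMeasure ν]
    (h : ∀ k : ℕ, ∫ x, (x : ℝ) ^ k ∂μ = ∫ x, (x : ℝ) ^ k ∂ν) : μ = ν := by
  have hint : ∀ (ρ : Measure I) [IsFiniteMeasure ρ] (φ : C(I, ℝ)), Integrable φ ρ := fun ρ _ φ =>
    (BoundedContinuousFunction.mkOfCompact φ).integrable _
  have hcont : ∀ (ρ : Measure I) [IsFiniteMeasure ρ], Continuous fun φ : C(I, ℝ) => ∫ x, φ x ∂ρ := by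
    intro ρ _
    have := (continuous_integral (μ := ρ) (G := ℝ)).comp
      (ContinuousMap.toLp (E := ℝ) 1 ρ ℝ).continuous
    refine this.congr fun φ => integral_congr_ae (ContinuousMap.coeFn_toLp ρ φ)
  have hpoly : ∀ p : Polynomial ℝ, ∫ x : I, p.eval (x : ℝ) ∂μ = ∫ x : I, p.eval (x : ℝ) ∂ν := by
    intro p
    simp_rw [Polynomial.eval_eq_sum_range]
    rw [integral_finsetSum _ fun i _ => hint μ ⟨fun x : I => p.coeff i * (x : ℝ) ^ i, by fun_prop⟩,
      integral_finsetSum _ fun i _ => hint ν ⟨fun x : I => p.coeff i * (x : ℝ) ^ i, by fun_prop⟩]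
    simp_rw [integral_const_mul, h]
  have hclosed : IsClosed {φ : C(I, ℝ) | ∫ x, φ x ∂μ = ∫ x, φ x ∂ν} :=
    isClosed_eq (hcont μ) (hcont ν)
  refine ext_of_forall_integral_eq_of_IsFiniteMeasure fun φ => ?_
  have hmem : φ.toContinuousMap ∈ (polynomialFunctions I).topologicalClosure := by
    rw [polynomialFunctions.topologicalClosure]; trivial
  refine closure_minimal ?_ hclosed hmem
  intro ψ hψ
  obtain ⟨p, -, rfl⟩ := (polynomialFunctions_coe (R := ℝ) I ▸ hψ : ψ ∈ _)
  exact hpoly p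

theorem ae_eq_of_limitDensity_eq [MeasurableSpace A] [DiscreteMeasurableSpace A]
    (hf : IsLimitTuple f) (hg : IsLimitTuple g)
    (h : ∀ (l : ℕ) (u : Word A l), limitDensity u f = limitDensity u g) (a : A) :
    f a =ᵐ[volume] g a := by
  have hS : ∀ (l : ℕ) (u : Word A l), simplexLIntegral u f = simplexLIntegral u g := by
    intro l u
    have hl : (l.factorial : ℝ) ≠ 0 := by exact_mod_cast l.factorial_ne_zero
    have h1 := h l u
    rw [limitDensity_eq hf, limitDensity_eq hg] at h1
    exact (ENNReal.toReal_eq_toReal_iff' (simplexLIntegral_ne_top hf u)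
      (simplexLIntegral_ne_top hg u)).1 (mul_left_cancel₀ hl h1)
  have hpow : ∀ {p : A → I → I}, IsLimitTuple p → ∀ k : ℕ,
      ∫ x, (x : ℝ) ^ k ∂(volume.withDensity fun x => ENNReal.ofReal (p a x : ℝ)) =
        k.factorial * (∑ v : Word A k, simplexLIntegral (Fin.snoc v a : Word A (k + 1)) p).toReal := by
    intro p hp k
    have hk : (0 : ℝ) < k.factorial := by exact_mod_cast k.factorial_pos
    rw [integral_eq_lintegral_of_nonneg_ae (ae_of_all _ fun x => pow_nonneg x.2.1 k)
      (by fun_prop), lintegral_withDensity_eq_lintegral_mul₀ (hp.aemeasurable_ofReal a)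
        (by fun_prop), sum_simplexLIntegral_snoc hp,
      ← ENNReal.toReal_ofReal_mul _ _ hk.le, ← lintegral_const_mul' _ _ ENNReal.ofReal_ne_top]
    congr 1
    refine lintegral_congr fun x => ?_
    rw [Pi.mul_apply, mul_left_comm, ← ENNReal.ofReal_mul hk.le,
      mul_div_cancel₀ _ hk.ne']
  have hfin : ∀ p : A → I → I,
      IsFiniteMeasure ((volume : Measure I).withDensity fun x => ENNReal.ofReal (p a x : ℝ)) :=
    fun p => isFiniteMeasure_withDensity_ofReal (p a)
  have hmeas : (volume : Measure I).withDensity (fun x => ENNReal.ofReal (f a x : ℝ)) =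
      volume.withDensity fun x => ENNReal.ofReal (g a x : ℝ) := by
    refine measure_eq_of_integral_pow_eq fun k => ?_
    rw [hpow hf, hpow hg]
    simp_rw [hS]
  have hae := (withDensity_eq_iff_of_sigmaFinite (hf.aemeasurable_ofReal a)
    (hg.aemeasurable_ofReal a)).1 hmeas
  filter_upwards [hae] with x hx
  exact Subtype.ext ((ENNReal.ofReal_eq_ofReal_iff (f a x).2.1 (g a x).2.1).1 hx)

end Uniqueness

end WordLimits

theorem mainTheorem12 {A : Type*} [Fintype A] [MeasurableSpace A] [DiscreteMeasurableSpace A] :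
    (∀ (len : ℕ → ℕ) (w : ∀ n, WordLimits.Word A (len n)), Tendsto len atTop atTop →
      WordLimits.Convergent w →
      ∃ f : A → I → I, WordLimits.IsLimitTuple f ∧ WordLimits.ConvergesTo w f ∧
        ∀ g : A → I → I, WordLimits.IsLimitTuple g → WordLimits.ConvergesTo w g →
          ∀ a, f a =ᵐ[volume] g a) ∧
    (∀ f : A → I → I, WordLimits.IsLimitTuple f →
      (∃ w : ∀ n, WordLimits.Word A n, WordLimits.ConvergesTo w f) ∧
      ∀ {Ω : Type*} [MeasurableSpace Ω] (P : Measure Ω) [IsProbabilityMeasure P]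
        (W : ∀ n, Ω → WordLimits.Word A n), (∀ n, WordLimits.IsRandomWord P f n (W n)) →
        ∀ᵐ ω ∂P, WordLimits.ConvergesTo (fun n => W n ω) f) := by
  refine ⟨fun len w hlen hw => ?_, fun f hf => ⟨WordLimits.exists_convergesTo hf,
    fun P _ W hW => WordLimits.ae_convergesTo_of_isRandomWord hf hW⟩⟩
  obtain ⟨f, hf, hwf⟩ := hw.exists_convergesTo hlen
  exact ⟨f, hf, hwf, fun g hg hwg => WordLimits.ae_eq_of_limitDensity_eq hf hg fun l u =>
    tendsto_nhds_unique (hwf l u) (hwg l u)⟩
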